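/- Let $G$ be a locally compact (Hausdorff) abelian group with Haar measure $m$ and dual group $\Gamma$; for $\lambda\in\Gamma$ write $\chi_\lambda$ for the corresponding character of $G$, and let $0\in\Gamma$ be the neutral element, i.e. the trivial character. A mean on $L^\infty(G)$ is a continuous linear functional $\varphi$ on the complex space $L^\infty(G)$ with $\varphi(\psi)\ge 0$ for all $\psi\ge 0$ and $\varphi(\mathbf 1)=1$. It is called topologically invariant if $\varphi(f*\psi)=\varphi(\psi)$ for all $\psi\in L^\infty(G)$ and all $f\in L^1(G)$ with $f\ge 0$ and $\int_G f\,dm=1$, where $(f*\psi)(x)=\int_G f(t)\psi(x-t)\,dm(t)$. A function $\psi\in L^\infty(G)$ is almost convergent to $\alpha\in\mathbb C$ if $\varphi(\psi)=\alpha$ for every topologically invariant mean $\varphi$ on $L^\infty(G)$. **Theorem 6.2.** Let $\mu$ be a bounded regular complex Borel measure on $\Gamma$. Then the function $$\hat\mu^*(x)=\int_\Gamma \chi_\lambda(x)\,d\mu(\lambda),\qquad x\in G,$$ belongs to $L^\infty(G)$ and is almost convergent to $\mu(\{0\})$. -/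

import Mathlib

open MeasureTheory
open scoped ENNReal

noncomputable section

namespace AlmostConvergence

section LInfty

variable {G : Type*} [AddCommGroup G] [TopologicalSpace G] [IsTopologicalAddGroup G]
  [LocallyCompactSpace G] [MeasurableSpace G] [BorelSpace G]
  (m : Measure G) [m.IsAddHaarMeasure] [m.Regular]

/-- The convolution `(f * ψ)(x) = ∫ f(t) ψ(x - t) dm(t)`, as a function on `G`. -/
def convFun (f : Lp ℂ 1 m) (ψ : Lp ℂ ∞ m) (x : G) : ℂ :=
  ∫ t, f t * ψ (x - t) ∂m

theorem convFun_eq_lpPairing (f : Lp ℂ 1 m) (ψ : Lp ℂ ∞ m) (x : G) :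
    convFun m f ψ x =
      (ContinuousLinearMap.mul ℂ ℂ).lpPairing m 1 ∞ (DomAddAct.mk x +ᵥ f)
        (Lp.compMeasurePreserving (fun t : G => -t) (Measure.measurePreserving_neg m) ψ) := by
  rw [ContinuousLinearMap.lpPairing_eq_integral]
  have h1 : convFun m f ψ x = ∫ t, f (x + t) * ψ (-t) ∂m := by
    unfold convFun
    rw [← integral_add_left_eq_self (fun t => f t * ψ (x - t)) x]
    simp
  rw [h1]
  apply integral_congr_ae
  filter_upwards [DomAddAct.vadd_Lp_ae_eq (DomAddAct.mk x) f,
    Lp.coeFn_compMeasurePreserving ψ (Measure.measurePreserving_neg m)] with t h2 h3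
  rw [ContinuousLinearMap.mul_apply', h2]
  erw [h3]
  simp

theorem continuous_convFun (f : Lp ℂ 1 m) (ψ : Lp ℂ ∞ m) : Continuous (convFun m f ψ) := by
  have h : convFun m f ψ = fun x =>
      (ContinuousLinearMap.mul ℂ ℂ).lpPairing m 1 ∞ (DomAddAct.mk x +ᵥ f)
        (Lp.compMeasurePreserving (fun t : G => -t) (Measure.measurePreserving_neg m) ψ) :=
    funext (convFun_eq_lpPairing m f ψ)
  rw [h]
  have : Fact ((1 : ℝ≥0∞) ≠ ∞) := ⟨ENNReal.one_ne_top⟩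
  have h1 : Continuous fun x : G => DomAddAct.mk x +ᵥ f :=
    (DomAddAct.continuous_mk (M := G)).vadd continuous_const
  exact (((ContinuousLinearMap.mul ℂ ℂ).lpPairing m 1 ∞).continuous.comp h1).clm_apply
    continuous_const

theorem norm_convFun_le (f : Lp ℂ 1 m) (ψ : Lp ℂ ∞ m) (x : G) :
    ‖convFun m f ψ x‖ ≤ ‖(ContinuousLinearMap.mul ℂ ℂ).lpPairing m 1 ∞‖ * ‖f‖ * ‖ψ‖ := by
  rw [convFun_eq_lpPairing]
  refine (ContinuousLinearMap.le_opNorm₂ _ _ _).trans (le_of_eq ?_)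
  rw [DomAddAct.norm_vadd_Lp, Lp.norm_compMeasurePreserving]

theorem memLp_convFun (f : Lp ℂ 1 m) (ψ : Lp ℂ ∞ m) : MemLp (convFun m f ψ) ∞ m :=
  memLp_top_of_bound (continuous_convFun m f ψ).measurable.aestronglyMeasurable _
    (Filter.Eventually.of_forall (norm_convFun_le m f ψ))

/-- The convolution `f * ψ` of `f ∈ L¹(G)` and `ψ ∈ L^∞(G)`, as an element of `L^∞(G)`. -/
def conv (f : Lp ℂ 1 m) (ψ : Lp ℂ ∞ m) : Lp ℂ ∞ m :=
  (memLp_convFun m f ψ).toLp (convFun m f ψ)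

open scoped ComplexOrder in
/-- The set `P(G)` of positive elements of `L¹(G)` of integral one. In the order of `ℂ` that is
used here, `0 ≤ z` says that `z` is real and nonnegative. -/
def probDensities : Set (Lp ℂ 1 m) :=
  {f | (∀ᵐ x ∂m, 0 ≤ f x) ∧ ∫ x, f x ∂m = 1}

open scoped ComplexOrder in
/-- A mean on `L^∞(G)`: a positive continuous linear functional with value `1` at the constant
function one. -/
structure IsMean (φ : Lp ℂ ∞ m →L[ℂ] ℂ) : Prop where
  nonneg : ∀ ψ : Lp ℂ ∞ m, (∀ᵐ x ∂m, 0 ≤ ψ x) → 0 ≤ φ ψ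
  map_one : φ ((memLp_top_const (1 : ℂ)).toLp fun _ : G => (1 : ℂ)) = 1

/-- A topologically invariant mean on `L^∞(G)`. -/
structure IsTopInvariantMean (φ : Lp ℂ ∞ m →L[ℂ] ℂ) : Prop extends IsMean m φ where
  map_conv : ∀ f ∈ probDensities m, ∀ ψ : Lp ℂ ∞ m, φ (conv m f ψ) = φ ψ

/-- The function `ψ` on `G` belongs to `L^∞(G)` and is almost convergent to `α`: every
topologically invariant mean takes the value `α` at `ψ`. -/
def AlmostConvergesTo (ψ : G → ℂ) (α : ℂ) : Prop :=
  ∃ hψ : MemLp ψ ∞ m, ∀ φ : Lp ℂ ∞ m →L[ℂ] ℂ, IsTopInvariantMean m φ → φ (hψ.toLp ψ) = α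

end LInfty

section Dual

variable (G : Type*) [AddCommGroup G] [TopologicalSpace G]

/-- The dual group `Γ` of the additive group `G`: the continuous characters of `G` with the
topology of uniform convergence on compact sets. Mathlib writes it multiplicatively, so that the
neutral element of `Γ` (the trivial character) is `1`. -/
abbrev DualGroup : Type _ := PontryaginDual (Multiplicative G)

variable {G}

/-- The character `χ_lam` of `G` that belongs to the element `lam` of the dual group. -/
def character (lam : DualGroup G) (x : G) : ℂ :=
  (lam (Multiplicative.ofAdd x) : ℂ)

variable [MeasurableSpace (DualGroup G)]

/-- The Fourier-Stieltjes function `x ↦ ∫ χ_lam(x) dμ(lam)` on `G` of a complex measure `μ` on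
the dual group of `G`. -/
def fourierStieltjes (μ : ComplexMeasure (DualGroup G)) (x : G) : ℂ :=
  μ.integral (fun lam => character lam x) (ContinuousLinearMap.mul ℝ ℂ)

end Dual

end AlmostConvergence

end

/-! Topologically invariant means are translation invariant (`IsTopInvariantMean.map_translate`), so
they do not change when `ψ` is replaced by the average of `ψ` and its translate by `a`. For a
Fourier-Stieltjes function this averaging multiplies the density by `(1 + χ_lam(a)) / 2`, which is
`1` at the trivial character, has modulus at most `1`, and modulus below `1` where `χ_lam(a) ≠ 1`.

By regularity, a compact set `K` of nontrivial characters carries almost all of the variation of `μ`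
off the trivial character. A finite product of such factors is below `1` in modulus on `K`, so its
powers tend in `L¹` of the variation to the indicator of the trivial character
(`exists_integral_averagingMultiplier_pow_sub_lt`). The transforms then come uniformly close to the
constant `μ {1}`, while the mean keeps its value throughout. -/

noncomputable section

namespace AlmostConvergence

open Filter Topology

/-! ### Probability densities from sets of finite positive measure -/

section Density

variable {G : Type*} [MeasurableSpace G] (m : Measure G)

/-- The normalised indicator function of a set, as an element of `L¹(G)`. -/
def normalizedIndicator {s : Set G} (hs : MeasurableSet s) (hfin : m s ≠ ∞) : Lp ℂ 1 m :=
  indicatorConstLp 1 hs hfin (((m.real s)⁻¹ : ℝ) : ℂ)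

open scoped ComplexOrder in
theorem normalizedIndicator_mem_probDensities {s : Set G} (hs : MeasurableSet s)
    (hfin : m s ≠ ∞) (hpos : m s ≠ 0) : normalizedIndicator m hs hfin ∈ probDensities m := by
  constructor
  · filter_upwards [indicatorConstLp_coeFn (p := 1) (hs := hs) (hμs := hfin)
      (c := (((m.real s)⁻¹ : ℝ) : ℂ))] with x hx
    rw [normalizedIndicator, hx]
    refine Set.indicator_nonneg (fun _ _ => ?_) x
    exact_mod_cast inv_nonneg.2 measureReal_nonneg
  · rw [normalizedIndicator, integral_indicatorConstLp, Complex.real_smul, ← Complex.ofReal_mul,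
      mul_inv_cancel₀ ((measureReal_ne_zero_iff hfin).2 hpos), Complex.ofReal_one]

end Density

/-! ### Translation invariance of topologically invariant means -/

section Translation

variable {G : Type*} [AddCommGroup G] [TopologicalSpace G] [IsTopologicalAddGroup G]
  [LocallyCompactSpace G] [MeasurableSpace G] [BorelSpace G]
  (m : Measure G) [m.IsAddHaarMeasure] [m.Regular]

theorem measurePreserving_sub_left (x : G) : MeasurePreserving (fun t => x - t) m m := by
  simpa [Function.comp_def, sub_eq_neg_add] using
    (measurePreserving_add_right m x).comp (Measure.measurePreserving_neg m)

theorem convFun_normalizedIndicator {s : Set G} (hs : MeasurableSet s) (hfin : m s ≠ ∞)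
    {ψ : G → ℂ} (hψ : MemLp ψ ∞ m) (x : G) :
    convFun m (normalizedIndicator m hs hfin) (hψ.toLp ψ) x =
      ∫ t, s.indicator (fun _ => (((m.real s)⁻¹ : ℝ) : ℂ)) t * ψ (x - t) ∂m := by
  -- The class of `ψ` is known only almost everywhere; `t ↦ x - t` preserves `m`, so its exceptional
  -- set pulls back to a null set.
  apply integral_congr_ae
  filter_upwards [indicatorConstLp_coeFn (p := 1) (hs := hs) (hμs := hfin)
      (c := (((m.real s)⁻¹ : ℝ) : ℂ)),
    (measurePreserving_sub_left m x).quasiMeasurePreserving.ae_eq_comp hψ.coeFn_toLp] with t h1 h2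
  rw [normalizedIndicator, h1]
  exact congrArg _ h2

/-- Topologically invariant means are translation invariant. -/
theorem IsTopInvariantMean.map_translate {φ : Lp ℂ ∞ m →L[ℂ] ℂ} (hφ : IsTopInvariantMean m φ)
    {ψ : G → ℂ} (hψ : MemLp ψ ∞ m) (a : G) (hψa : MemLp (fun x => ψ (x + a)) ∞ m) :
    φ (hψa.toLp _) = φ (hψ.toLp ψ) := by
  obtain ⟨K, hK, hK0⟩ := exists_compact_mem_nhds (0 : G)
  -- The closure is taken for measurability: `G` is not assumed Hausdorff here, so `K` need not be
  -- closed.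
  set s := closure K with hs_def
  have hsm : MeasurableSet s := isClosed_closure.measurableSet
  have hsfin : m s ≠ ∞ := hK.closure.measure_lt_top.ne
  have hs0 : m s ≠ 0 :=
    (Measure.measure_pos_of_mem_nhds m (mem_of_superset hK0 subset_closure)).ne'
  have hp := measurePreserving_add_right m a
  set s' := (fun t => t + a) ⁻¹' s with hs'_def
  have hsm' : MeasurableSet s' := hp.measurable hsm
  have hmeas : m s' = m s := hp.measure_preimage hsm.nullMeasurableSet
  have hreal : m.real s' = m.real s := by simp [Measure.real, hmeas]
  have hsfin' : m s' ≠ ∞ := hmeas ▸ hsfin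
  -- Substituting `t + a` for `t` moves the translation from `ψ` onto the density, which becomes
  -- that of `s' = s - a`.
  have key : conv m (normalizedIndicator m hsm hsfin) (hψa.toLp _) =
      conv m (normalizedIndicator m hsm' hsfin') (hψ.toLp ψ) := by
    unfold conv
    congr 1
    funext x
    rw [convFun_normalizedIndicator, convFun_normalizedIndicator,
      ← integral_add_right_eq_self
        (fun t => s.indicator (fun _ => (((m.real s)⁻¹ : ℝ) : ℂ)) t * ψ (x - t + a)) a]
    simp only [hreal, sub_add_eq_add_sub, add_sub_add_right_eq_sub]
    rfl
  rw [← hφ.map_conv _ (normalizedIndicator_mem_probDensities m hsm hsfin hs0), key,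
    hφ.map_conv _ (normalizedIndicator_mem_probDensities m hsm' hsfin' (hmeas ▸ hs0))]

end Translation

/-! ### Variation and integrals of complex measures -/

section ComplexMeasure

variable {X : Type*} [MeasurableSpace X]

/-- The variation is dominated by the sum of the total variations of the real and imaginary parts,
which are finite measures. -/
instance isFiniteMeasure_variation_complexMeasure (μ : ComplexMeasure X) :
    IsFiniteMeasure μ.variation := by
  have h : μ.variation ≤
      (ComplexMeasure.re μ).totalVariation + (ComplexMeasure.im μ).totalVariation := by
    refine VectorMeasure.variation_le_of_forall_enorm_le fun s _ => ?_
    have h1 : ‖μ s‖ₑ ≤ ‖(μ s).re‖ₑ + ‖(μ s).im‖ₑ := by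
      simp only [enorm_eq_nnnorm]
      exact_mod_cast Complex.norm_le_abs_re_add_abs_im (μ s)
    refine h1.trans (add_le_add ?_ ?_)
    · exact SignedMeasure.enorm_le_totalVariation (ComplexMeasure.re μ) s
    · exact SignedMeasure.enorm_le_totalVariation (ComplexMeasure.im μ) s
  exact isFiniteMeasure_of_le _ h

theorem norm_complexMeasure_integral_le (μ : ComplexMeasure X) (f : X → ℂ) :
    ‖μ.integral f (ContinuousLinearMap.mul ℝ ℂ)‖ ≤ ∫ x, ‖f x‖ ∂μ.variation := by
  refine VectorMeasure.norm_integral_le_integral_norm.trans ?_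
  exact mul_le_of_le_one_left (integral_nonneg fun _ => norm_nonneg _)
    (ContinuousLinearMap.opNorm_mul_le ℝ ℂ)

theorem complexMeasure_integral_indicator_const (μ : ComplexMeasure X) {s : Set X}
    (hs : MeasurableSet s) (c : ℂ) :
    μ.integral (s.indicator fun _ => c) (ContinuousLinearMap.mul ℝ ℂ) = c * μ s := by
  rw [VectorMeasure.integral_eq_setToFun,
    setToFun_indicator_const _ hs (measure_ne_top _ _)]
  rfl

end ComplexMeasure

/-! ### Characters and averaging multipliers -/

section Character

variable {G : Type*} [AddCommGroup G] [TopologicalSpace G]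

theorem norm_character (lam : DualGroup G) (x : G) : ‖character lam x‖ = 1 :=
  Circle.norm_coe _

theorem character_one (x : G) : character (1 : DualGroup G) x = 1 := by
  simp [character]

theorem character_add (lam : DualGroup G) (x y : G) :
    character lam (x + y) = character lam x * character lam y := by
  simp [character, ofAdd_add]

theorem exists_character_ne_one {lam : DualGroup G} (h : lam ≠ 1) :
    ∃ a, character lam a ≠ 1 := by
  by_contra! H
  refine h (PontryaginDual.ext fun a => ?_)
  exact Circle.ext (H a.toAdd)

theorem continuous_character_left (x : G) : Continuous fun lam : DualGroup G => character lam x :=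
  continuous_subtype_val.comp
    (ContinuousEvalConst.continuous_eval_const (F := Multiplicative G →ₜ* Circle)
      (Multiplicative.ofAdd x))

theorem continuous_character_uncurry [LocallyCompactSpace G] :
    Continuous fun p : DualGroup G × G => character p.1 p.2 := by
  have : LocallyCompactSpace (Multiplicative G) := ‹LocallyCompactSpace G›
  have h : Continuous fun p : (Multiplicative G →ₜ* Circle) × Multiplicative G => p.1 p.2 :=
    ContinuousEval.continuous_eval
  exact continuous_subtype_val.comp h

/-- Evaluations of characters at points close to each other are uniformly close on a compact set of the dual. -/
theorem eventually_forall_norm_character_sub_lt [LocallyCompactSpace G] {K : Set (DualGroup G)}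
    (hK : IsCompact K) (x₀ : G) {ε : ℝ} (hε : 0 < ε) :
    ∀ᶠ x in 𝓝 x₀, ∀ lam ∈ K, ‖character lam x - character lam x₀‖ < ε := by
  refine hK.eventually_forall_of_forall_eventually fun lam _ => ?_
  have hc : Continuous fun p : G × DualGroup G =>
      ‖character p.2 p.1 - character p.2 x₀‖ :=
    ((continuous_character_uncurry.comp continuous_swap).sub
      ((continuous_character_left x₀).comp continuous_snd)).norm
  have := hc.tendsto (x₀, lam)
  exact this.eventually_lt_const (by simpa using hε)

theorem norm_one_add_character_div_two_le (lam : DualGroup G) (a : G) :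
    ‖(1 + character lam a) / 2‖ ≤ 1 := by
  have := norm_add_le 1 (character lam a)
  rw [norm_character, norm_one] at this
  rw [norm_div, Complex.norm_ofNat]
  linarith

/-- Equality in the triangle inequality would put `1` and `χ(a)` on the same ray; having equal
norms, they would coincide. -/
theorem norm_one_add_character_div_two_lt {lam : DualGroup G} {a : G}
    (h : character lam a ≠ 1) : ‖(1 + character lam a) / 2‖ < 1 := by
  have h1 : ‖(1 : ℂ) + character lam a‖ < ‖(1 : ℂ)‖ + ‖character lam a‖ := by
    refine lt_of_le_of_ne (norm_add_le _ _) fun heq => h ?_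
    exact ((sameRay_iff_of_norm_eq (by rw [norm_character, norm_one])).1
      (sameRay_iff_norm_add.2 heq)).symm
  rw [norm_character, norm_one] at h1
  rw [norm_div, Complex.norm_ofNat]
  linarith

/-- The function `∏ (1 + χ(a)) / 2` on the dual group, the product being over a finite set of
points `a`. -/
def averagingMultiplier (A : Finset G) (lam : DualGroup G) : ℂ :=
  ∏ a ∈ A, (1 + character lam a) / 2

theorem averagingMultiplier_one (A : Finset G) : averagingMultiplier A 1 = 1 := by
  simp [averagingMultiplier, character_one]

theorem continuous_averagingMultiplier (A : Finset G) : Continuous (averagingMultiplier A) :=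
  continuous_finsetProd _ fun a _ => (continuous_const.add (continuous_character_left a)).div_const _

theorem norm_averagingMultiplier_le (A : Finset G) (lam : DualGroup G) :
    ‖averagingMultiplier A lam‖ ≤ 1 := by
  rw [averagingMultiplier, norm_prod]
  exact Finset.prod_le_one (fun _ _ => norm_nonneg _)
    fun a _ => norm_one_add_character_div_two_le lam a

theorem norm_averagingMultiplier_lt {A : Finset G} {lam : DualGroup G} {a : G} (ha : a ∈ A)
    (h : character lam a ≠ 1) : ‖averagingMultiplier A lam‖ < 1 := by
  classical
  rw [averagingMultiplier, ← Finset.mul_prod_erase A _ ha, norm_mul]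
  exact mul_lt_one_of_nonneg_of_lt_one_left (norm_nonneg _)
    (norm_one_add_character_div_two_lt h) (norm_averagingMultiplier_le (A.erase a) lam)

/-- A compact set of nontrivial characters is separated from the trivial one by finitely many
points of the group. -/
theorem exists_norm_averagingMultiplier_lt {K : Set (DualGroup G)} (hK : IsCompact K)
    (h1 : (1 : DualGroup G) ∉ K) : ∃ A : Finset G, ∀ lam ∈ K, ‖averagingMultiplier A lam‖ < 1 := by
  -- Each nontrivial character differs from `1` at some `a`, so these open sets cover `K`.
  obtain ⟨A, hA⟩ := hK.elim_finite_subcover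
    (fun a : G => {lam : DualGroup G | character lam a ≠ 1})
    (fun a => isOpen_ne_fun (continuous_character_left a) continuous_const)
    (fun lam hlam => Set.mem_iUnion.2 (exists_character_ne_one fun h => h1 (h ▸ hlam)))
  refine ⟨A, fun lam hlam => ?_⟩
  obtain ⟨a, ha, hne⟩ := Set.mem_iUnion₂.1 (hA hlam)
  exact norm_averagingMultiplier_lt ha hne

end Character

/-! ### Weighted Fourier-Stieltjes transforms -/

section Transform

variable {G : Type*} [AddCommGroup G] [TopologicalSpace G]
  [MeasurableSpace (DualGroup G)] [BorelSpace (DualGroup G)] (μ : ComplexMeasure (DualGroup G))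

/-- The Fourier-Stieltjes function of the complex measure with density `h` with respect to `μ`. -/
def weightedFourierStieltjes (h : DualGroup G → ℂ) (x : G) : ℂ :=
  μ.integral (fun lam => character lam x * h lam) (ContinuousLinearMap.mul ℝ ℂ)

theorem integrable_character_mul {h : DualGroup G → ℂ} (hm : Measurable h)
    (hb : ∀ lam, ‖h lam‖ ≤ 1) (x : G) :
    Integrable (fun lam => character lam x * h lam) μ.variation := by
  refine Integrable.of_bound
    ((continuous_character_left x).measurable.mul hm).aestronglyMeasurable 1 ?_
  exact Eventually.of_forall fun lam => by rw [norm_mul, norm_character, one_mul]; exact hb lam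

/-- Since characters have modulus one, the bound is independent of `x`: approximation of densities
in `L¹` of the variation becomes uniform approximation on `G`. -/
theorem norm_weightedFourierStieltjes_sub_le {h k : DualGroup G → ℂ} (hm : Measurable h)
    (hb : ∀ lam, ‖h lam‖ ≤ 1) (km : Measurable k) (kb : ∀ lam, ‖k lam‖ ≤ 1) (x : G) :
    ‖weightedFourierStieltjes μ h x - weightedFourierStieltjes μ k x‖ ≤
      ∫ lam, ‖h lam - k lam‖ ∂μ.variation := by
  rw [weightedFourierStieltjes, weightedFourierStieltjes, ← VectorMeasure.integral_fun_sub
    (integrable_character_mul μ hm hb x) (integrable_character_mul μ km kb x)]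
  refine (norm_complexMeasure_integral_le μ _).trans (le_of_eq ?_)
  congr 1
  funext lam
  rw [← mul_sub, norm_mul, norm_character, one_mul]

theorem norm_weightedFourierStieltjes_le {h : DualGroup G → ℂ} (hm : Measurable h)
    (hb : ∀ lam, ‖h lam‖ ≤ 1) (x : G) :
    ‖weightedFourierStieltjes μ h x‖ ≤ ∫ lam, ‖h lam‖ ∂μ.variation := by
  have := norm_weightedFourierStieltjes_sub_le μ hm hb (k := 0) measurable_zero (by simp) x
  simpa [weightedFourierStieltjes] using this

theorem weightedFourierStieltjes_indicator_one (x : G) :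
    weightedFourierStieltjes μ (({1} : Set (DualGroup G)).indicator 1) x = μ {1} := by
  have h : (fun lam => character lam x * ({1} : Set (DualGroup G)).indicator 1 lam) =
      ({1} : Set (DualGroup G)).indicator fun _ => (1 : ℂ) := by
    funext lam
    by_cases hl : lam = 1
    · simp [hl, character_one]
    · simp [hl]
  rw [weightedFourierStieltjes, h,
    complexMeasure_integral_indicator_const μ (measurableSet_singleton _), one_mul]

theorem weightedFourierStieltjes_average {h : DualGroup G → ℂ} (hm : Measurable h)
    (hb : ∀ lam, ‖h lam‖ ≤ 1) (a x : G) :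
    weightedFourierStieltjes μ (fun lam => (1 + character lam a) / 2 * h lam) x =
      (1 / 2 : ℂ) * (weightedFourierStieltjes μ h x + weightedFourierStieltjes μ h (x + a)) := by
  have h1 : (fun lam => character lam x * ((1 + character lam a) / 2 * h lam)) =
      fun lam => (1 / 2 : ℝ) • (character lam x * h lam + character lam (x + a) * h lam) := by
    funext lam
    rw [character_add, Complex.real_smul]
    push_cast
    ring
  rw [weightedFourierStieltjes, h1, VectorMeasure.integral_fun_smul, VectorMeasure.integral_fun_add
    (integrable_character_mul μ hm hb x) (integrable_character_mul μ hm hb (x + a)),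
    Complex.real_smul]
  push_cast
  rfl

/-- Regularity leaves little variation outside a compact set, and on that set characters vary
uniformly little near `x₀`. Continuity supplies the measurability needed for membership in `L^∞(G)`.
-/
theorem continuous_weightedFourierStieltjes [IsTopologicalAddGroup G] [LocallyCompactSpace G]
    (hμ : μ.variation.Regular) {h : DualGroup G → ℂ} (hm : Measurable h)
    (hb : ∀ lam, ‖h lam‖ ≤ 1) : Continuous (weightedFourierStieltjes μ h) := by
  rw [continuous_iff_continuousAt]
  intro x₀
  rw [ContinuousAt, Metric.tendsto_nhds]
  intro ε hε
  set M := μ.variation.real Set.univ with hM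
  have hM0 : 0 ≤ M := measureReal_nonneg
  -- The error is at most `M * δ` from `K` and `2 * δ` from its complement; `M + 3` makes the final
  -- inequality strict.
  set δ := ε / (M + 3) with hδ
  have hδ0 : 0 < δ := by positivity
  obtain ⟨K, -, hK, hKδ⟩ := MeasurableSet.univ.exists_isCompact_sdiff_lt
    (measure_ne_top μ.variation _) (ENNReal.ofReal_pos.2 hδ0).ne'
  rw [← Set.compl_eq_univ_sdiff] at hKδ
  have hKc : μ.variation.real Kᶜ ≤ δ := ENNReal.toReal_le_of_le_ofReal hδ0.le hKδ.le
  filter_upwards [eventually_forall_norm_character_sub_lt hK x₀ hδ0] with x hx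
  rw [dist_eq_norm, weightedFourierStieltjes, weightedFourierStieltjes,
    ← VectorMeasure.integral_fun_sub
    (integrable_character_mul μ hm hb x) (integrable_character_mul μ hm hb x₀)]
  refine (norm_complexMeasure_integral_le μ _).trans_lt ?_
  have hKm : MeasurableSet K := hK.measurableSet
  calc ∫ lam, ‖character lam x * h lam - character lam x₀ * h lam‖ ∂μ.variation
      ≤ ∫ lam, (δ + Kᶜ.indicator (fun _ => (2 : ℝ)) lam) ∂μ.variation := by
        refine integral_mono
          ((integrable_character_mul μ hm hb x).sub (integrable_character_mul μ hm hb x₀)).norm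
          ((integrable_const _).add ((integrable_const _).indicator hKm.compl)) fun lam => ?_
        have h1 : ‖character lam x * h lam - character lam x₀ * h lam‖ ≤
            ‖character lam x - character lam x₀‖ := by
          rw [← sub_mul, norm_mul]
          exact mul_le_of_le_one_right (norm_nonneg _) (hb lam)
        refine h1.trans ?_
        by_cases hl : lam ∈ K
        · simpa [hl] using (hx lam hl).le
        · have := norm_sub_le (character lam x) (character lam x₀)
          rw [norm_character, norm_character] at this
          simp only [Set.mem_compl_iff, hl, not_false_eq_true, Set.indicator_of_mem]
          linarith
    _ = M * δ + μ.variation.real Kᶜ * 2 := by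
        rw [integral_add (integrable_const _) ((integrable_const _).indicator hKm.compl),
          integral_indicator_const _ hKm.compl, integral_const, smul_eq_mul, smul_eq_mul]
    _ ≤ M * δ + δ * 2 := by gcongr
    _ < (M + 3) * δ := by linarith
    _ = ε := by rw [hδ]; field_simp

/-- Powers of suitable averaging multipliers approximate the indicator function of the trivial
character in `L¹` of the variation. -/
theorem exists_integral_averagingMultiplier_pow_sub_lt (hμ : μ.variation.Regular) {ε : ℝ}
    (hε : 0 < ε) : ∃ (A : Finset G) (n : ℕ),
      ∫ lam, ‖averagingMultiplier A lam ^ n - ({1} : Set (DualGroup G)).indicator 1 lam‖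
        ∂μ.variation < ε := by
  obtain ⟨K, hK1, hK, hKε⟩ := (measurableSet_singleton (1 : DualGroup G)).compl
    |>.exists_isCompact_sdiff_lt (measure_ne_top μ.variation _)
      (ENNReal.ofReal_pos.2 (half_pos hε)).ne'
  have hKm : MeasurableSet K := hK.measurableSet
  set R := ({1}ᶜ : Set (DualGroup G)) \ K with hR
  have hRm : MeasurableSet R := (measurableSet_singleton _).compl.diff hKm
  have hRε : μ.variation.real R ≤ ε / 2 :=
    ENNReal.toReal_le_of_le_ofReal (half_pos hε).le hKε.le
  obtain ⟨A, hA⟩ := exists_norm_averagingMultiplier_lt hK fun h => hK1 h rfl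
  have hpow_le : ∀ n lam, ‖averagingMultiplier A lam ^ n‖ ≤ 1 := fun n lam => by
    rw [norm_pow]
    exact pow_le_one₀ (norm_nonneg _) (norm_averagingMultiplier_le A lam)
  have hpow_meas : ∀ n, Measurable fun lam => averagingMultiplier A lam ^ n := fun n =>
    ((continuous_averagingMultiplier A).pow n).measurable
  -- On `K` the powers tend to `0` pointwise and are bounded by `1`, so dominated convergence
  -- applies.
  set F : ℕ → DualGroup G → ℝ := fun n => K.indicator fun lam => ‖averagingMultiplier A lam ^ n‖
    with hF
  have hFm : ∀ n, Measurable (F n) := fun n => (hpow_meas n).norm.indicator hKm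
  have hFb : ∀ n lam, ‖F n lam‖ ≤ 1 := fun n lam => by
    refine (norm_indicator_le_norm_self _ _).trans ?_
    rw [norm_norm]
    exact hpow_le n lam
  have hlim : Tendsto (fun n => ∫ lam, F n lam ∂μ.variation) atTop (𝓝 0) := by
    have := tendsto_integral_of_dominated_convergence (μ := μ.variation) (F := F)
      (f := fun _ => (0 : ℝ)) (fun _ => 1) (fun n => (hFm n).aestronglyMeasurable)
      (integrable_const _) (fun n => Eventually.of_forall (hFb n))
      (Eventually.of_forall fun lam => by
        by_cases hl : lam ∈ K
        · simpa [hF, hl] using tendsto_pow_atTop_nhds_zero_of_lt_one (norm_nonneg _) (hA lam hl)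
        · simp [hF, hl])
    simpa using this
  obtain ⟨n, hn⟩ := (hlim.eventually_lt_const (half_pos hε)).exists
  refine ⟨A, n, ?_⟩
  have hint1 : Integrable (F n) μ.variation :=
    Integrable.of_bound (hFm n).aestronglyMeasurable 1 (Eventually.of_forall (hFb n))
  have hint2 : Integrable (R.indicator fun _ => (1 : ℝ)) μ.variation :=
    (integrable_const _).indicator hRm
  -- Pointwise, the difference vanishes at the trivial character, equals `F n` in norm on `K`, and
  -- is at most `1` on the remainder `R`.
  calc _ ≤ ∫ lam, (F n lam + R.indicator (fun _ => (1 : ℝ)) lam) ∂μ.variation := by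
        refine integral_mono_of_nonneg (Eventually.of_forall fun _ => norm_nonneg _)
          (hint1.add hint2) (Eventually.of_forall fun lam => ?_)
        by_cases h1 : lam = 1
        · subst h1
          have : (1 : DualGroup G) ∉ K := fun h => hK1 h rfl
          simp [averagingMultiplier_one, hF, hR, this]
        · by_cases hl : lam ∈ K
          · simp [hF, hR, h1, hl]
          · simpa [hF, hR, h1, hl] using hpow_le n lam
    _ = (∫ lam, F n lam ∂μ.variation) + μ.variation.real R := by
        rw [integral_add hint1 hint2, integral_indicator_const _ hRm, smul_eq_mul, mul_one]
    _ < ε := by linarith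

end Transform

/-! ### Invariance of the mean under averaging multipliers -/

section Mean

variable {G : Type*} [AddCommGroup G] [TopologicalSpace G] [IsTopologicalAddGroup G]
  [LocallyCompactSpace G] [MeasurableSpace G] [BorelSpace G]
  {m : Measure G}
  [MeasurableSpace (DualGroup G)] [BorelSpace (DualGroup G)] {μ : ComplexMeasure (DualGroup G)}

variable (m) in
theorem memLp_weightedFourierStieltjes (hμ : μ.variation.Regular) {h : DualGroup G → ℂ}
    (hm : Measurable h) (hb : ∀ lam, ‖h lam‖ ≤ 1) :
    MemLp (weightedFourierStieltjes μ h) ∞ m :=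
  memLp_top_of_bound
    (continuous_weightedFourierStieltjes μ hμ hm hb).measurable.aestronglyMeasurable _
    (Eventually.of_forall (norm_weightedFourierStieltjes_le μ hm hb))

variable [m.IsAddHaarMeasure] [m.Regular] {φ : Lp ℂ ∞ m →L[ℂ] ℂ}

theorem IsTopInvariantMean.map_weightedFourierStieltjes_average
    (hφ : IsTopInvariantMean m φ) (hμ : μ.variation.Regular) {h : DualGroup G → ℂ}
    (hm : Measurable h) (hb : ∀ lam, ‖h lam‖ ≤ 1) (a : G)
    (h' : MemLp (weightedFourierStieltjes μ fun lam => (1 + character lam a) / 2 * h lam) ∞ m) :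
    φ (h'.toLp _) = φ ((memLp_weightedFourierStieltjes m hμ hm hb).toLp _) := by
  have hψ := memLp_weightedFourierStieltjes m hμ hm hb
  have hψa : MemLp (fun x => weightedFourierStieltjes μ h (x + a)) ∞ m :=
    hψ.comp_measurePreserving (measurePreserving_add_right m a)
  have heq : h'.toLp _ = (1 / 2 : ℂ) • (hψ.toLp _ + hψa.toLp _) := by
    rw [← MemLp.toLp_add, ← MemLp.toLp_const_smul]
    congr 1
    funext x
    exact weightedFourierStieltjes_average μ hm hb a x
  rw [heq, map_smul, map_add, hφ.map_translate m hψ a hψa, smul_eq_mul]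
  ring

/-- The product is absorbed one point at a time. The free factor `h` allows iteration to powers. -/
theorem IsTopInvariantMean.map_weightedFourierStieltjes_averagingMultiplier_mul
    (hφ : IsTopInvariantMean m φ) (hμ : μ.variation.Regular) (A : Finset G)
    {h : DualGroup G → ℂ} (hm : Measurable h) (hb : ∀ lam, ‖h lam‖ ≤ 1)
    (h' : MemLp (weightedFourierStieltjes μ fun lam => averagingMultiplier A lam * h lam) ∞ m) :
    φ (h'.toLp _) = φ ((memLp_weightedFourierStieltjes m hμ hm hb).toLp _) := by
  classical
  induction A using Finset.induction_on with
  | empty => simp [averagingMultiplier]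
  | insert a A ha ih =>
    have hm' : Measurable fun lam => averagingMultiplier A lam * h lam :=
      (continuous_averagingMultiplier A).measurable.mul hm
    have hb' : ∀ lam, ‖averagingMultiplier A lam * h lam‖ ≤ 1 := fun lam => by
      rw [norm_mul]
      exact mul_le_one₀ (norm_averagingMultiplier_le A lam) (norm_nonneg _) (hb lam)
    rw [← ih (memLp_weightedFourierStieltjes m hμ hm' hb'),
      ← hφ.map_weightedFourierStieltjes_average hμ hm' hb' a
        (by simpa [averagingMultiplier, Finset.prod_insert ha, mul_assoc] using h')]
    simp [averagingMultiplier, Finset.prod_insert ha, mul_assoc]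

theorem IsTopInvariantMean.map_weightedFourierStieltjes_averagingMultiplier_pow
    (hφ : IsTopInvariantMean m φ) (hμ : μ.variation.Regular) (A : Finset G) (n : ℕ)
    (h1 : MemLp (weightedFourierStieltjes μ fun _ => 1) ∞ m)
    (h' : MemLp (weightedFourierStieltjes μ fun lam => averagingMultiplier A lam ^ n) ∞ m) :
    φ (h'.toLp _) = φ (h1.toLp _) := by
  induction n with
  | zero => simp
  | succ n ih =>
    have hm : Measurable fun lam => averagingMultiplier A lam ^ n :=
      ((continuous_averagingMultiplier A).pow n).measurable
    have hb : ∀ lam, ‖averagingMultiplier A lam ^ n‖ ≤ 1 := fun lam => by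
      rw [norm_pow]
      exact pow_le_one₀ (norm_nonneg _) (norm_averagingMultiplier_le A lam)
    rw [← ih (memLp_weightedFourierStieltjes m hμ hm hb),
      ← hφ.map_weightedFourierStieltjes_averagingMultiplier_mul hμ A hm hb
        (by simpa [pow_succ'] using h')]
    simp only [pow_succ']

end Mean

end AlmostConvergence

end

/-! ### The almost convergence theorem -/

theorem theorem6p2 {G : Type*} [AddCommGroup G] [TopologicalSpace G] [IsTopologicalAddGroup G]
    [T2Space G] [LocallyCompactSpace G] [MeasurableSpace G] [BorelSpace G]
    (m : Measure G) [m.IsAddHaarMeasure] [m.Regular]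
    [MeasurableSpace (AlmostConvergence.DualGroup G)]
    [BorelSpace (AlmostConvergence.DualGroup G)]
    (μ : ComplexMeasure (AlmostConvergence.DualGroup G)) (hμ : μ.variation.Regular) :
    AlmostConvergence.AlmostConvergesTo m (AlmostConvergence.fourierStieltjes μ) (μ {1}) := by
  open AlmostConvergence in
  have hone : fourierStieltjes μ = weightedFourierStieltjes μ fun _ => 1 := by
    funext x
    simp [fourierStieltjes, weightedFourierStieltjes]
  have h1 : MemLp (weightedFourierStieltjes μ fun _ => 1) ∞ m :=
    memLp_weightedFourierStieltjes m hμ measurable_const (by simp)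
  rw [hone]
  refine ⟨h1, fun φ hφ => ?_⟩
  have hc : φ ((memLp_top_const (μ {1})).toLp fun _ : G => μ {1}) = μ {1} := by
    have heq : (memLp_top_const (μ {1})).toLp (fun _ : G => μ {1}) =
        μ {1} • (memLp_top_const (1 : ℂ)).toLp (μ := m) (fun _ : G => (1 : ℂ)) := by
      rw [← MemLp.toLp_const_smul]
      congr 1
      funext x
      simp
    rw [heq, map_smul, hφ.map_one, smul_eq_mul, mul_one]
  rw [← sub_eq_zero, ← norm_le_zero_iff]
  refine le_of_forall_pos_le_add fun ε hε => ?_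
  -- The `+ 1` keeps the denominator positive without computing the norm of `φ`.
  obtain ⟨A, n, hAn⟩ := exists_integral_averagingMultiplier_pow_sub_lt μ hμ
    (div_pos hε (by positivity : 0 < ‖φ‖ + 1))
  have hm : Measurable fun lam => averagingMultiplier A lam ^ n :=
    ((continuous_averagingMultiplier A).pow n).measurable
  have hb : ∀ lam : DualGroup G, ‖averagingMultiplier A lam ^ n‖ ≤ 1 := fun lam => by
    rw [norm_pow]
    exact pow_le_one₀ (norm_nonneg _) (norm_averagingMultiplier_le A lam)
  have hP := memLp_weightedFourierStieltjes m hμ hm hb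
  rw [← hφ.map_weightedFourierStieltjes_averagingMultiplier_pow hμ A n h1 hP, ← hc, ← map_sub,
    ← MemLp.toLp_sub, zero_add]
  refine (φ.le_opNorm _).trans ?_
  have hnorm : ‖(hP.sub (memLp_top_const (μ {1}))).toLp _‖ ≤ ε / (‖φ‖ + 1) := by
    rw [Lp.norm_toLp]
    refine ENNReal.toReal_le_of_le_ofReal (by positivity) ?_
    rw [eLpNorm_exponent_top]
    refine eLpNormEssSup_le_of_ae_bound (Filter.Eventually.of_forall fun x => ?_)
    refine le_trans ?_ hAn.le
    -- The constant `μ {1}` is itself a transform, with the indicator of the trivial character as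
    -- density, so the uniform estimate applies.
    rw [Pi.sub_apply, ← weightedFourierStieltjes_indicator_one μ x]
    refine norm_weightedFourierStieltjes_sub_le μ hm hb
      (measurable_one.indicator (measurableSet_singleton _)) (fun lam => ?_) x
    exact (norm_indicator_le_norm_self _ _).trans (by simp)
  calc ‖φ‖ * _ ≤ (‖φ‖ + 1) * (ε / (‖φ‖ + 1)) := by
        gcongr
        linarith
    _ = ε := by field_simp
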